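/- Let $\Gamma=\Gamma_A\cup\Gamma_B$ be the hexagonal lattice, with $\Gamma_A=\mathrm{span}_{\mathbb Z}\{(\sqrt3,0),\tfrac12(\sqrt3,3)\}$ and $\Gamma_B=\Gamma_A+(0,1)$. Write $|j,k\rangle\otimes f_1$ for the site of $\Gamma_A$ with integer coordinates $(j,k)$ with respect to these two vectors, and $|j,k\rangle\otimes f_2$ for its translate by $(0,1)$ in $\Gamma_B$. On $\ell^2(\Gamma)$ let $S_1,S_2,S_3$ be the shifts $$\begin{aligned} S_1(|j,k\rangle\otimes f_1)&=|j,k-1\rangle\otimes f_2, & S_1(|j,k\rangle\otimes f_2)&=|j-1,k+1\rangle\otimes f_1,\\ S_2(|j,k\rangle\otimes f_1)&=|j+1,k-1\rangle\otimes f_2, & S_2(|j,k\rangle\otimes f_2)&=|j,k\rangle\otimes f_1,\\ S_3(|j,k\rangle\otimes f_1)&=|j,k\rangle\otimes f_2, & S_3(|j,k\rangle\otimes f_2)&=|j,k+1\rangle\otimes f_1. \end{aligned}$$ On $\mathcal H=\ell^2(\Gamma)\otimes\mathbb C^3$, with $e_1,e_2,e_3$ the standard basis of $\mathbb C^3$ and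 $x^{(i)}=|x\rangle\otimes e_i$, put $S=\sum_{m=1}^3 S_m\otimes|e_m\rangle\langle e_m|$. For a family $(C_x)_{x\in\Gamma}$ of unitary matrices $C_x\in U(3)$ and phases $\omega=(\omega_x)_{x\in\Gamma}$ put $\mathcal C(|x\rangle\otimes\tau)=|x\rangle\otimes C_x\tau$ and $D_\omega(|x\rangle\otimes\tau)=e^{i\omega_x}|x\rangle\otimes\tau$, and let $U_\omega=D_\omega S\mathcal C$, a unitary operator on $\mathcal H$. Let $\mu$ be a probability measure on $\mathbb T=[0,2\pi)$ that is absolutely continuous with respect to Lebesgue measure, with bounded density. **Theorem.** For every $s\in(0,1)$ there is a constant $C(s)<\infty$ (for the given $\mu$, depending only on $s$) such that $$\int_{\mathbb T}\int_{\mathbb T}\bigl|\langle x^{(i)}\,|\,(U_\omega-z)^{-1}y^{(j)}\rangle\bigr|^s\,d\mu(\omega_x)\,d\mu(\omega_y)\le C(s)$$ for all families $(C_x)_{x\in\Gamma}$ in $U(3)$, all $z\in\mathbb C$ with $|z|\ne1$, all $x,y\in\Gamma$, all $i,j\in\{1,2,3\}$, and arbitrary values of all other phases $\omega_v$, $v\notin\{x,y\}$;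 for $x=y$ the left-hand side is the single integral over $\omega_x$. Consequently, if $(\omega_v)_{v\in\Gamma}$ are i.i.d. random variables with law $\mu$, then, with the same constant, $$\mathbb E\Bigl(\bigl|\langle x^{(i)}\,|\,(U_\omega-z)^{-1}y^{(j)}\rangle\bigr|^s\Bigr)\le C(s).$$ -/

import Mathlib

open MeasureTheory ProbabilityTheory
open scoped ENNReal NNReal

noncomputable section

namespace HexWalk

/-- Sites of the hexagonal lattice: `(j, k, 0)` is the site `|j,k⟩ ⊗ f₁` of the sublattice `Γ_A`, at
the position `j (√3, 0) + k (√3/2, 3/2)` of the plane, and `(j, k, 1)` is the site `|j,k⟩ ⊗ f₂` of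
the sublattice `Γ_B = Γ_A + (0, 1)`, at the position `j (√3, 0) + k (√3/2, 3/2) + (0, 1)`. -/
abbrev Site : Type := ℤ × ℤ × Fin 2

/-- The coin space `ℂ³`; its standard basis vectors `e₁, e₂, e₃` are indexed by `0, 1, 2`. -/
abbrev Coin : Type := EuclideanSpace ℂ (Fin 3)

/-- The Hilbert space `ℓ²(Γ; ℂ³) ≃ ℓ²(Γ) ⊗ ℂ³`. -/
abbrev Hil : Type := lp (fun _ : Site => Coin) 2

/-- The basis vector `x⁽ⁱ⁾ = |x⟩ ⊗ eᵢ`. -/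
def ket (x : Site) (i : Fin 3) : Hil := lp.single 2 x (EuclideanSpace.single i (1 : ℂ))

/-- The shift along the `m`-th direction on sites (`m = 0, 1, 2` for `S₁, S₂, S₃`). -/
def shiftSite : Fin 3 → Site → Site
  | 0, (j, k, 0) => (j, k - 1, 1)
  | 0, (j, k, 1) => (j - 1, k + 1, 0)
  | 1, (j, k, 0) => (j + 1, k - 1, 1)
  | 1, (j, k, 1) => (j, k, 0)
  | 2, (j, k, 0) => (j, k, 1)
  | 2, (j, k, 1) => (j, k + 1, 0)

/-- The inverse of `shiftSite`. -/
def unshiftSite : Fin 3 → Site → Site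
  | 0, (j, k, 0) => (j + 1, k - 1, 1)
  | 0, (j, k, 1) => (j, k + 1, 0)
  | 1, (j, k, 0) => (j, k, 1)
  | 1, (j, k, 1) => (j - 1, k + 1, 0)
  | 2, (j, k, 0) => (j, k - 1, 1)
  | 2, (j, k, 1) => (j, k, 0)

/-- The shift on sites is a permutation. -/
def shiftPerm (m : Fin 3) : Equiv.Perm Site where
  toFun := shiftSite m
  invFun := unshiftSite m
  left_inv := by
    rintro ⟨j, k, t⟩
    fin_cases m <;> fin_cases t <;> simp [shiftSite, unshiftSite]
  right_inv := by
    rintro ⟨j, k, t⟩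
    fin_cases m <;> fin_cases t <;> simp [shiftSite, unshiftSite]

lemma hasSum_norm_sq (ψ : Hil) : HasSum (fun x => ‖ψ x‖ ^ 2) (‖ψ‖ ^ 2) := by
  simpa using lp.hasSum_norm (p := 2) (by norm_num) ψ

lemma memℓp_two_of_summable {f : Site → Coin} (h : Summable fun x => ‖f x‖ ^ 2) :
    Memℓp f 2 :=
  memℓp_gen (by simpa using h)

lemma norm_eq_of_hasSum {ψ φ : Hil} (h : HasSum (fun x => ‖φ x‖ ^ 2) (‖ψ‖ ^ 2)) : ‖φ‖ = ‖ψ‖ :=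
  (sq_eq_sq₀ (norm_nonneg _) (norm_nonneg _)).1 ((hasSum_norm_sq φ).unique h)

lemma hasSum_permute (σ : Fin 3 → Equiv.Perm Site) (ψ : Hil) :
    HasSum (fun x => ‖(WithLp.toLp 2 fun m => ψ ((σ m).symm x) m : Coin)‖ ^ 2) (‖ψ‖ ^ 2) := by
  have hs : ∀ m, Summable fun x => ‖ψ x m‖ ^ 2 := fun m =>
    (hasSum_norm_sq ψ).summable.of_nonneg_of_le (fun _ => sq_nonneg _) fun x => by
      gcongr
      exact PiLp.norm_apply_le (ψ x) m
  have h1 : HasSum (fun x => ∑ m, ‖ψ x m‖ ^ 2) (∑ m, ∑' x, ‖ψ x m‖ ^ 2) :=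
    hasSum_sum fun m _ => (hs m).hasSum
  have h2 : HasSum (fun x => ∑ m, ‖ψ x m‖ ^ 2) (‖ψ‖ ^ 2) := by
    simpa only [EuclideanSpace.norm_sq_eq] using hasSum_norm_sq ψ
  simp only [EuclideanSpace.norm_sq_eq]
  rw [h2.unique h1]
  exact hasSum_sum fun m _ => ((σ m).symm.hasSum_iff).2 (hs m).hasSum

/-- The isometry which moves the `m`-th coin component by the permutation `σ m` of the sites:
`|x⟩ ⊗ eₘ ↦ |σ m x⟩ ⊗ eₘ`. -/
def permute (σ : Fin 3 → Equiv.Perm Site) : Hil →ₗᵢ[ℂ] Hil where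
  toFun ψ := ⟨fun x => WithLp.toLp 2 fun m => ψ ((σ m).symm x) m,
    memℓp_two_of_summable (hasSum_permute σ ψ).summable⟩
  map_add' _ _ := rfl
  map_smul' _ _ := rfl
  norm_map' ψ := norm_eq_of_hasSum (hasSum_permute σ ψ)

/-- The unitary shift operator `S = ∑ₘ Sₘ ⊗ |eₘ⟩⟨eₘ|`. -/
def shiftOp : Hil ≃ₗᵢ[ℂ] Hil where
  toFun := permute shiftPerm
  invFun := permute fun m => (shiftPerm m).symm
  map_add' := map_add _
  map_smul' := map_smul _
  left_inv ψ := by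
    ext x m
    exact congrArg (fun y => ψ y m) ((shiftPerm m).symm_apply_apply x)
  right_inv ψ := by
    ext x m
    exact congrArg (fun y => ψ y m) ((shiftPerm m).apply_symm_apply x)
  norm_map' := (permute shiftPerm).norm_map

lemma hasSum_fiberwise (V : Site → Coin ≃ₗᵢ[ℂ] Coin) (ψ : Hil) :
    HasSum (fun x => ‖V x (ψ x)‖ ^ 2) (‖ψ‖ ^ 2) := by
  simpa only [LinearIsometryEquiv.norm_map] using hasSum_norm_sq ψ

/-- The unitary operator that acts on the coin space of the site `x` by the unitary map `V x`:
`|x⟩ ⊗ τ ↦ |x⟩ ⊗ V x τ`. -/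
def fiberwise (V : Site → Coin ≃ₗᵢ[ℂ] Coin) : Hil ≃ₗᵢ[ℂ] Hil where
  toFun ψ := ⟨fun x => V x (ψ x), memℓp_two_of_summable (hasSum_fiberwise V ψ).summable⟩
  invFun ψ := ⟨fun x => (V x).symm (ψ x),
    memℓp_two_of_summable (hasSum_fiberwise (fun x => (V x).symm) ψ).summable⟩
  map_add' ψ φ := by
    ext1
    funext x
    exact map_add (V x) (ψ x) (φ x)
  map_smul' c ψ := by
    ext1
    funext x
    exact map_smul (V x) c (ψ x)
  left_inv ψ := by
    ext1
    funext x
    exact (V x).symm_apply_apply (ψ x)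
  right_inv ψ := by
    ext1
    funext x
    exact (V x).apply_symm_apply (ψ x)
  norm_map' ψ := norm_eq_of_hasSum (hasSum_fiberwise V ψ)

/-- The action `τ ↦ A τ` on the coin space of a unitary `3 × 3` matrix `A`. -/
def matrixAction (A : Matrix.unitaryGroup (Fin 3) ℂ) : Coin ≃ₗᵢ[ℂ] Coin :=
  Unitary.linearIsometryEquiv
    ⟨Matrix.toEuclideanCLM (n := Fin 3) (𝕜 := ℂ) (A : Matrix (Fin 3) (Fin 3) ℂ),
      Unitary.map_mem (Matrix.toEuclideanCLM (n := Fin 3) (𝕜 := ℂ)) A.2⟩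

/-- The multiplication `τ ↦ e^{iθ} τ` by a phase on the coin space. -/
def phaseAction (θ : ℝ) : Coin ≃ₗᵢ[ℂ] Coin where
  toFun τ := Circle.exp θ • τ
  invFun τ := (Circle.exp θ)⁻¹ • τ
  map_add' := smul_add _
  map_smul' c τ := smul_comm _ c τ
  left_inv := inv_smul_smul _
  right_inv := smul_inv_smul _
  norm_map' τ := by simp [Circle.smul_def, norm_smul]

/-- The coin operator `|x⟩ ⊗ τ ↦ |x⟩ ⊗ C_x τ` of a family of unitary coin matrices. -/
def coinOp (C : Site → Matrix.unitaryGroup (Fin 3) ℂ) : Hil ≃ₗᵢ[ℂ] Hil :=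
  fiberwise fun x => matrixAction (C x)

/-- The operator `D_ω : |x⟩ ⊗ τ ↦ e^{i ω_x} |x⟩ ⊗ τ`. -/
def phaseOp (ω : Site → ℝ) : Hil ≃ₗᵢ[ℂ] Hil :=
  fiberwise fun x => phaseAction (ω x)

/-- The quantum walk `U_ω = D_ω S 𝒞`, a unitary operator. -/
def walk (C : Site → Matrix.unitaryGroup (Fin 3) ℂ) (ω : Site → ℝ) : Hil ≃ₗᵢ[ℂ] Hil :=
  ((coinOp C).trans shiftOp).trans (phaseOp ω)

/-- The resolvent `(U_ω - z)⁻¹`, for `|z| ≠ 1`; see `isUnit_walk_sub`. -/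
def resolventOp (C : Site → Matrix.unitaryGroup (Fin 3) ℂ) (ω : Site → ℝ) (z : ℂ) : Hil →L[ℂ] Hil :=
  Ring.inverse (((walk C ω : Hil ≃L[ℂ] Hil) : Hil →L[ℂ] Hil) - z • (1 : Hil →L[ℂ] Hil))

/-- The matrix element `⟨x⁽ⁱ⁾ | (U_ω - z)⁻¹ y⁽ʲ⁾⟩` of the resolvent. -/
def green (C : Site → Matrix.unitaryGroup (Fin 3) ℂ) (ω : Site → ℝ) (z : ℂ)
    (x : Site) (i : Fin 3) (y : Site) (j : Fin 3) : ℂ :=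
  inner ℂ (ket x i) (resolventOp C ω z (ket y j))

/-- `U_ω - z` is invertible for `|z| ≠ 1`. -/
lemma isUnit_walk_sub (C : Site → Matrix.unitaryGroup (Fin 3) ℂ) (ω : Site → ℝ) {z : ℂ}
    (hz : ‖z‖ ≠ 1) :
    IsUnit (((walk C ω : Hil ≃L[ℂ] Hil) : Hil →L[ℂ] Hil) - z • (1 : Hil →L[ℂ] Hil)) := by
  have hu := (Unitary.linearIsometryEquiv.symm (walk C ω)).2
  by_contra h
  have hmem : z ∈ spectrum ℂ ((walk C ω : Hil ≃L[ℂ] Hil) : Hil →L[ℂ] Hil) := by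
    rw [spectrum.mem_iff, Algebra.algebraMap_eq_smul_one, ← IsUnit.neg_iff, neg_sub]
    exact h
  exact hz (by simpa using spectrum.subset_circle_of_unitary (𝕜 := ℂ) hu hmem)

/-- A measure on `ℝ` that is concentrated on the torus `[0, 2π)` and has there a density with
respect to Lebesgue measure which is essentially bounded. -/
def HasBoundedDensityOnTorus (μ : Measure ℝ) : Prop :=
  ∃ τ : ℝ → ℝ≥0∞, Measurable τ ∧
    μ = (volume.restrict (Set.Ico 0 (2 * Real.pi))).withDensity τ ∧
    ∃ M : ℝ≥0, ∀ᵐ θ ∂(volume.restrict (Set.Ico 0 (2 * Real.pi))), τ θ ≤ M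

end HexWalk

end

noncomputable section

namespace HexWalk

/-! The two phases are traded for a relative and a common one: with `ω_x = a + b` and `ω_y = b`,
only the integral over `b` is needed, at fixed `a`. The bounded density first replaces `μ` by a
multiple of Lebesgue measure, and `2π`-periodicity then makes the substitution free.

A common phase turns the walk into `(1 + (w - 1) P) A` with `w = e^{ib}`, where `P` projects onto
the sites `x, y` and fixes both basis vectors. Up to elementary algebra the resolvent becomes `(1 -
c (1 + (w - 1) P) A)⁻¹` with `|c| < 1`. For `e` in the range of `P`, its diagonal element `F(w)` is
holomorphic near the closed disc and has positive real part there, since a strict contraction is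
inverted. Hence `|F|^s ≤ Re (F^s) / cos(sπ/2)`, and the mean value property bounds the integral over
the circle by `F(0)`, which equals `‖e‖²` whatever `A` and `c` are. This is the source of the
uniformity. Polarization within the range of `P` gives the off-diagonal elements
(`lintegral_inner_inverse_le`), and `lintegral_lintegral_green_le` assembles the two-phase bound.

The bound for i.i.d. phases follows by resampling the coordinates `x` and `y` of the product
measure. -/

/-! ### Fractional moments of holomorphic functions with positive real part. -/

/-- For `0 < s < 1` and `w` in the right half-plane, `‖w‖ ^ s` is controlled by `Re (w ^ s)`. -/
lemma cos_mul_norm_rpow_le_re_cpow {s : ℝ} (hs : s ∈ Set.Ioo (0 : ℝ) 1) {w : ℂ} (hw : 0 < w.re) :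
    Real.cos (s * (Real.pi / 2)) * ‖w‖ ^ s ≤ (w ^ (s : ℂ)).re := by
  have harg : |w.arg| < Real.pi / 2 := Complex.abs_arg_lt_pi_div_two_iff.2 (.inl hw)
  have hre : (w ^ (s : ℂ)).re = ‖w‖ ^ s * Real.cos (w.arg * s) := by
    rw [Complex.cpow_ofReal, Complex.re_ofReal_mul, Complex.add_re, Complex.ofReal_re,
      Complex.re_ofReal_mul, Complex.I_re, mul_zero, add_zero]
  rw [hre, mul_comm]
  gcongr
  rw [← Real.cos_abs (w.arg * s), abs_mul, abs_of_pos hs.1, mul_comm s]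
  apply Real.cos_le_cos_of_nonneg_of_le_pi
  · have := hs.1
    positivity
  · nlinarith [hs.1, hs.2, Real.pi_pos]
  · exact mul_le_mul_of_nonneg_right harg.le hs.1.le

lemma cos_mul_pi_div_two_pos {s : ℝ} (hs : s ∈ Set.Ioo (0 : ℝ) 1) :
    0 < Real.cos (s * (Real.pi / 2)) :=
  Real.cos_pos_of_mem_Ioo ⟨by nlinarith [hs.1, Real.pi_pos], by nlinarith [hs.2, Real.pi_pos]⟩

/-- Kolmogorov's bound on the fractional moments of a holomorphic function with positive real
part. -/
lemma lintegral_circle_rpow_le_of_re_pos {s : ℝ} (hs : s ∈ Set.Ioo (0 : ℝ) 1) {F : ℂ → ℂ}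
    (hF : ∀ w ∈ Metric.closedBall (0 : ℂ) 1, DifferentiableAt ℂ F w)
    (hre : ∀ w ∈ Metric.closedBall (0 : ℂ) 1, 0 < (F w).re) :
    ∫⁻ θ in Set.Ioc 0 (2 * Real.pi), ‖F (circleMap 0 1 θ)‖ₑ ^ s ≤
      ENNReal.ofReal (2 * Real.pi * ((Real.cos (s * (Real.pi / 2)))⁻¹ * ‖F 0‖ ^ s)) := by
  have hcos := cos_mul_pi_div_two_pos hs
  have hd : ∀ w ∈ Metric.closedBall (0 : ℂ) 1, DifferentiableAt ℂ (fun w => F w ^ (s : ℂ)) w :=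
    fun w hw => (hF w hw).cpow_const (Or.inl (hre w hw))
  have hcirc : ∀ θ, circleMap 0 1 θ ∈ Metric.closedBall (0 : ℂ) 1 := fun θ =>
    circleMap_mem_closedBall 0 zero_le_one θ
  have hc1 : Continuous fun θ => F (circleMap 0 1 θ) := continuous_iff_continuousAt.2 fun θ =>
    ContinuousAt.comp (f := circleMap 0 1) (hF _ (hcirc θ)).continuousAt
      (continuous_circleMap 0 1).continuousAt
  have hc2 : Continuous fun θ => F (circleMap 0 1 θ) ^ (s : ℂ) := continuous_iff_continuousAt.2
    fun θ => ContinuousAt.comp (f := circleMap 0 1) (g := fun w => F w ^ (s : ℂ))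
      (hd _ (hcirc θ)).continuousAt (continuous_circleMap 0 1).continuousAt
  have hc3 : Continuous fun θ => ‖F (circleMap 0 1 θ)‖ ^ s :=
    hc1.norm.rpow_const fun _ => .inr hs.1.le
  have hmean : ∫ θ in (0)..2 * Real.pi, F (circleMap 0 1 θ) ^ (s : ℂ) =
      (2 * Real.pi : ℝ) * F 0 ^ (s : ℂ) := by
    have hdc : DiffContOnCl ℂ (fun w => F w ^ (s : ℂ)) (Metric.ball 0 |1|) := by
      refine DifferentiableOn.diffContOnCl fun w hw => (hd w ?_).differentiableWithinAt
      simpa [closure_ball] using hw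
    have h := hdc.circleAverage
    rw [Real.circleAverage_def] at h
    rw [← h, ← Complex.real_smul, smul_smul, mul_inv_cancel₀ (by positivity), one_smul]
  have hmean' : ∫ θ in (0)..2 * Real.pi, (F (circleMap 0 1 θ) ^ (s : ℂ)).re =
      2 * Real.pi * (F 0 ^ (s : ℂ)).re := by
    have h := Complex.reCLM.intervalIntegral_comp_comm (hc2.intervalIntegrable (μ := volume)
      0 (2 * Real.pi))
    simp only [Complex.reCLM_apply] at h
    rw [h, hmean, Complex.re_ofReal_mul]
  have hbound : ∫ θ in (0)..2 * Real.pi, ‖F (circleMap 0 1 θ)‖ ^ s ≤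
      2 * Real.pi * ((Real.cos (s * (Real.pi / 2)))⁻¹ * ‖F 0‖ ^ s) := by
    have h1 : ∫ θ in (0)..2 * Real.pi,
        Real.cos (s * (Real.pi / 2)) * ‖F (circleMap 0 1 θ)‖ ^ s ≤
        ∫ θ in (0)..2 * Real.pi, (F (circleMap 0 1 θ) ^ (s : ℂ)).re :=
      intervalIntegral.integral_mono_on (by positivity)
        ((continuous_const.mul hc3).intervalIntegrable _ _)
        ((Complex.continuous_re.comp hc2).intervalIntegrable _ _)
        fun θ _ => cos_mul_norm_rpow_le_re_cpow hs (hre _ (hcirc θ))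
    rw [intervalIntegral.integral_const_mul, hmean'] at h1
    have h2 : (F 0 ^ (s : ℂ)).re ≤ ‖F 0‖ ^ s := by
      refine (Complex.re_le_norm _).trans (le_of_eq ?_)
      rw [Complex.norm_cpow_of_ne_zero]
      · simp
      · intro h
        have := hre 0 (by simp)
        simp [h] at this
    rw [← mul_assoc, mul_comm (2 * Real.pi), mul_assoc, inv_mul_eq_div, le_div_iff₀' hcos]
    exact h1.trans (by gcongr)
  rw [intervalIntegral.integral_of_le (by positivity)] at hbound
  refine le_trans (le_of_eq ?_) (ENNReal.ofReal_le_ofReal hbound)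
  rw [ofReal_integral_eq_lintegral_ofReal
    ((hc3.integrableOn_Icc).mono_set Set.Ioc_subset_Icc_self)
    (.of_forall fun θ => by positivity)]
  refine lintegral_congr fun θ => ?_
  rw [← ofReal_norm, ENNReal.ofReal_rpow_of_nonneg (norm_nonneg _) hs.1.le]

/-! ### Matrix elements of inverses of `1 - K` for strict contractions `K`. -/

section Resolvent

variable {H : Type*} [NormedAddCommGroup H] [InnerProductSpace ℂ H]

/-- Only diagonal elements have a positive real part, so off-diagonal ones are reduced to them. The
factor `1/4` of the polarization identity is discarded. -/
lemma enorm_inner_map_le_polarization (T : H →L[ℂ] H) (e f : H) :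
    ‖inner ℂ e (T f)‖ₑ ≤ ‖inner ℂ (f + e) (T (f + e))‖ₑ + ‖inner ℂ (f - e) (T (f - e))‖ₑ +
      ‖inner ℂ (f + Complex.I • e) (T (f + Complex.I • e))‖ₑ +
      ‖inner ℂ (f - Complex.I • e) (T (f - Complex.I • e))‖ₑ := by
  simp only [enorm_eq_nnnorm]
  norm_cast
  rw [← NNReal.coe_le_coe]
  push_cast
  have h := inner_map_polarization' (T : H →ₗ[ℂ] H) f e
  simp only [ContinuousLinearMap.coe_coe] at h
  rw [← norm_inner_symm, h, norm_div]
  rw [div_le_iff₀ (by simp)]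
  refine (norm_add_le _ _).trans ?_
  have h1 := norm_sub_le (inner ℂ (T (f + e)) (f + e) - inner ℂ (T (f - e)) (f - e))
    (Complex.I * inner ℂ (T (f + Complex.I • e)) (f + Complex.I • e))
  have h2 := norm_sub_le (inner ℂ (T (f + e)) (f + e)) (inner ℂ (T (f - e)) (f - e))
  rw [norm_mul, Complex.norm_I, one_mul] at h1 ⊢
  rw [norm_inner_symm (T (f + e)), norm_inner_symm (T (f - e))] at h2
  rw [norm_inner_symm (T (f + _))] at h1
  rw [norm_inner_symm (T (f - Complex.I • e))]
  rw [show ‖(4 : ℂ)‖ = 4 by simp]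
  linarith [norm_nonneg (inner ℂ (f + e) (T (f + e))), norm_nonneg (inner ℂ (f - e) (T (f - e))),
    norm_nonneg (inner ℂ (f + Complex.I • e) (T (f + Complex.I • e))),
    norm_nonneg (inner ℂ (f - Complex.I • e) (T (f - Complex.I • e)))]

variable [CompleteSpace H]

/-- With `v = (1 - K)⁻¹ e`, the real part is `‖v‖² - Re ⟨K v, v⟩ ≥ (1 - ‖K‖) ‖v‖²`. -/
lemma re_inner_inverse_one_sub_pos {K : H →L[ℂ] H} (hK : ‖K‖ < 1) {e : H} (he : e ≠ 0) :
    0 < (inner ℂ e (Ring.inverse (1 - K) e)).re := by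
  have hu := isUnit_one_sub_of_norm_lt_one hK
  set v := Ring.inverse (1 - K) e with hv
  have hev : e = v - K v := by
    have := congrArg (fun T : H →L[ℂ] H => T e) (Ring.mul_inverse_cancel _ hu)
    simpa using this.symm
  have hv0 : v ≠ 0 := by
    rintro h
    rw [h] at hev
    simp [he] at hev
  have h1 : (inner ℂ (K v) v).re ≤ ‖K‖ * ‖v‖ ^ 2 := by
    refine (Complex.re_le_norm _).trans ((norm_inner_le_norm _ _).trans ?_)
    rw [sq, ← mul_assoc]
    gcongr
    exact K.le_opNorm v
  have h2 : (inner ℂ v v).re = ‖v‖ ^ 2 := by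
    rw [inner_self_eq_norm_sq_to_K]
    norm_cast
  rw [hev, inner_sub_left, Complex.sub_re, h2]
  have : 0 < ‖v‖ ^ 2 := by positivity
  nlinarith

/-- The fractional moment bound for the diagonal matrix elements of `(1 - (1 + (w - 1) P) A)⁻¹`,
where `w` runs through the unit circle. -/
lemma lintegral_inner_inverse_self_le {s : ℝ} (hs : s ∈ Set.Ioo (0 : ℝ) 1) {A P : H →L[ℂ] H}
    (hA : ‖A‖ < 1) (hP : ∀ w : ℂ, ‖w‖ ≤ 1 → ‖1 + (w - 1) • P‖ ≤ 1) {e : H}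
    (he : ∀ v, inner ℂ e (P v) = inner ℂ e v) :
    ∫⁻ θ in Set.Ioc 0 (2 * Real.pi),
      ‖inner ℂ e (Ring.inverse (1 - (1 + (circleMap 0 1 θ - 1) • P) * A) e)‖ₑ ^ s ≤
      ENNReal.ofReal (2 * Real.pi * ((Real.cos (s * (Real.pi / 2)))⁻¹ * (‖e‖ ^ 2) ^ s)) := by
  rcases eq_or_ne e 0 with rfl | he0
  · simp [ENNReal.zero_rpow_of_pos hs.1]
  have hK : ∀ w ∈ Metric.closedBall (0 : ℂ) 1, ‖(1 + (w - 1) • P) * A‖ < 1 := fun w hw => by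
    refine (norm_mul_le _ _).trans_lt ?_
    have := hP w (by simpa using hw)
    nlinarith [norm_nonneg A]
  refine (lintegral_circle_rpow_le_of_re_pos hs
    (F := fun w => inner ℂ e (Ring.inverse (1 - (1 + (w - 1) • P) * A) e))
    (fun w hw => ?_) fun w hw => re_inner_inverse_one_sub_pos (hK w hw) he0).trans (le_of_eq ?_)
  · have h1 : DifferentiableAt ℂ (fun w : ℂ => 1 - (1 + (w - 1) • P) * A) w := by fun_prop
    have h2 := (differentiableAt_inverse (𝕜 := ℂ)
      (isUnit_one_sub_of_norm_lt_one (hK w hw))).comp w h1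
    exact ((innerSL ℂ e).comp (ContinuousLinearMap.apply ℂ H e)).differentiableAt.comp w h2
  -- At `w = 0` the operator is `1 - (1 - P) A`, and `e` is orthogonal to the range of `1 - P`; so
  -- pairing `v - (1 - P) A v = e` with `e` gives `⟨e, v⟩ = ‖e‖²`.
  · have hu := isUnit_one_sub_of_norm_lt_one (hK 0 (by simp))
    set v := Ring.inverse (1 - (1 + ((0 : ℂ) - 1) • P) * A) e with hv
    have hev : v - (A v - P (A v)) = e := by
      have : (1 - (1 + ((0 : ℂ) - 1) • P) * A) v = e :=
        congrArg (fun T : H →L[ℂ] H => T e) (Ring.mul_inverse_cancel _ hu)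
      simpa [-neg_sub, sub_eq_add_neg] using this
    have : inner ℂ e v = ((‖e‖ ^ 2 : ℝ) : ℂ) := by
      calc inner ℂ e v = inner ℂ e (v - (A v - P (A v))) := by
            rw [inner_sub_right, inner_sub_right, he, sub_self, sub_zero]
        _ = _ := by rw [hev, inner_self_eq_norm_sq_to_K]; norm_cast
    rw [this]
    simp

/-- The bound on the fractional moments that comes from Kolmogorov's bound and polarization. -/
def momentBound (s : ℝ) : ℝ≥0 :=
  4 * Real.toNNReal (2 * Real.pi * ((Real.cos (s * (Real.pi / 2)))⁻¹ * 4 ^ s))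

/-- The fractional moment bound for the matrix elements of `(1 - (1 + (w - 1) P) A)⁻¹`, where `w`
runs through the unit circle. -/
lemma lintegral_inner_inverse_le {s : ℝ} (hs : s ∈ Set.Ioo (0 : ℝ) 1) {A P : H →L[ℂ] H}
    (hA : ‖A‖ < 1) (hP : ∀ w : ℂ, ‖w‖ ≤ 1 → ‖1 + (w - 1) • P‖ ≤ 1) {e f : H}
    (he : ∀ v, inner ℂ e (P v) = inner ℂ e v) (hf : ∀ v, inner ℂ f (P v) = inner ℂ f v)
    (he1 : ‖e‖ ≤ 1) (hf1 : ‖f‖ ≤ 1) :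
    ∫⁻ θ in Set.Ioc 0 (2 * Real.pi),
      ‖inner ℂ e (Ring.inverse (1 - (1 + (circleMap 0 1 θ - 1) • P) * A) f)‖ₑ ^ s ≤
      momentBound s := by
  set R : ℝ → H →L[ℂ] H := fun θ => Ring.inverse (1 - (1 + (circleMap 0 1 θ - 1) • P) * A) with hR
  have hRc : Continuous R := by
    refine continuous_iff_continuousAt.2 fun θ => ?_
    have hu : ‖(1 + (circleMap 0 1 θ - 1) • P) * A‖ < 1 := by
      refine (norm_mul_le _ _).trans_lt ?_
      have := hP (circleMap 0 1 θ) (by simp)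
      nlinarith [norm_nonneg A]
    have h2 := (differentiableAt_inverse (𝕜 := ℂ)
      (isUnit_one_sub_of_norm_lt_one hu)).continuousAt
    have h1 : ContinuousAt (fun θ => 1 - (1 + (circleMap 0 1 θ - 1) • P) * A) θ := by
      have := continuous_circleMap 0 1
      fun_prop
    exact ContinuousAt.comp (g := Ring.inverse) h2 h1
  have hm : ∀ v, Measurable fun θ => ‖inner ℂ v (R θ v)‖ₑ ^ s := fun v => by
    have : Continuous fun θ => inner ℂ v (R θ v) := by fun_prop
    exact this.measurable.enorm.pow_const s
  -- The four polarization vectors have norm at most `2`, hence `(‖v‖²)^s ≤ 4^s`.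
  have hv : ∀ v, (∀ u, inner ℂ v (P u) = inner ℂ v u) → ‖v‖ ≤ 2 →
      ∫⁻ θ in Set.Ioc 0 (2 * Real.pi), ‖inner ℂ v (R θ v)‖ₑ ^ s ≤
        ENNReal.ofReal (2 * Real.pi * ((Real.cos (s * (Real.pi / 2)))⁻¹ * 4 ^ s)) := by
    intro v hvP hv2
    refine (lintegral_inner_inverse_self_le hs hA hP hvP).trans (ENNReal.ofReal_le_ofReal ?_)
    have := cos_mul_pi_div_two_pos hs
    have := hs.1
    gcongr
    nlinarith [norm_nonneg v]
  have hIe : ‖Complex.I • e‖ ≤ 1 := by rwa [norm_smul, Complex.norm_I, one_mul]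
  calc ∫⁻ θ in Set.Ioc 0 (2 * Real.pi), ‖inner ℂ e (R θ f)‖ₑ ^ s
      ≤ ∫⁻ θ in Set.Ioc 0 (2 * Real.pi), (‖inner ℂ (f + e) (R θ (f + e))‖ₑ ^ s +
        ‖inner ℂ (f - e) (R θ (f - e))‖ₑ ^ s +
        ‖inner ℂ (f + Complex.I • e) (R θ (f + Complex.I • e))‖ₑ ^ s +
        ‖inner ℂ (f - Complex.I • e) (R θ (f - Complex.I • e))‖ₑ ^ s) := by
        -- Subadditivity of `t ↦ t^s` for `s ≤ 1` splits the polarization bound.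
        refine lintegral_mono fun θ => ?_
        refine (ENNReal.rpow_le_rpow (enorm_inner_map_le_polarization (R θ) e f) hs.1.le).trans ?_
        have h := fun a b : ℝ≥0∞ => ENNReal.rpow_add_le_add_rpow a b hs.1.le hs.2.le
        refine (h _ _).trans (add_le_add_left ?_ _)
        refine (h _ _).trans (add_le_add_left ?_ _)
        exact h _ _
    _ ≤ momentBound s := by
        rw [lintegral_add_right _ (hm _), lintegral_add_right _ (hm _),
          lintegral_add_right _ (hm _)]
        have h1 := hv (f + e) (fun u => by simp only [inner_add_left, he, hf])
          ((norm_add_le _ _).trans (by linarith))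
        have h2 := hv (f - e) (fun u => by simp only [inner_sub_left, he, hf])
          ((norm_sub_le _ _).trans (by linarith))
        have h3 := hv (f + Complex.I • e)
          (fun u => by simp only [inner_add_left, inner_smul_left, he, hf])
          ((norm_add_le _ _).trans (by linarith))
        have h4 := hv (f - Complex.I • e)
          (fun u => by simp only [inner_sub_left, inner_smul_left, he, hf])
          ((norm_sub_le _ _).trans (by linarith))
        refine (add_le_add (add_le_add (add_le_add h1 h2) h3) h4).trans (le_of_eq ?_)
        rw [momentBound, ENNReal.coe_mul, ENNReal.ofReal]
        push_cast
        ring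

end Resolvent

/-! ### From the resolvent of a unitary operator to inverses of `1 - c U` with `|c| < 1`. -/

section Unitary

variable {H : Type*} [NormedAddCommGroup H] [InnerProductSpace ℂ H]

lemma abs_one_sub_norm_mul_norm_le (U : H ≃ₗᵢ[ℂ] H) (z : ℂ) (g : H) :
    |1 - ‖z‖| * ‖g‖ ≤ ‖U g - z • g‖ := by
  have h := abs_norm_sub_norm_le (U g) (z • g)
  rwa [U.norm_map, norm_smul, ← one_sub_mul, abs_mul, abs_norm] at h

variable [CompleteSpace H]

/-- The adjoint of `(1 - z̄ U)⁻¹` is `1 + z (U - z)⁻¹`, because `U* = U⁻¹`; this exchanges `e` and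
`f`. Dividing by `z` costs a factor `2` when `|z| > 1/2`; for smaller `z` the resolvent itself has
norm at most `2`. -/
lemma norm_inner_inverse_sub_le_of_norm_lt_one (U : H ≃ₗᵢ[ℂ] H) {z : ℂ} (hz : ‖z‖ < 1)
    (hu : IsUnit (((U : H ≃L[ℂ] H) : H →L[ℂ] H) - z • (1 : H →L[ℂ] H)))
    (hU : ‖((U : H ≃L[ℂ] H) : H →L[ℂ] H)‖ ≤ 1) {e f : H} (he : ‖e‖ ≤ 1) (hf : ‖f‖ ≤ 1) :
    ‖inner ℂ e (Ring.inverse (((U : H ≃L[ℂ] H) : H →L[ℂ] H) - z • (1 : H →L[ℂ] H)) f)‖ ≤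
      2 * (1 + ‖inner ℂ f
        (Ring.inverse (1 - starRingEnd ℂ z • ((U : H ≃L[ℂ] H) : H →L[ℂ] H)) e)‖) := by
  have hz' : ‖starRingEnd ℂ z • ((U : H ≃L[ℂ] H) : H →L[ℂ] H)‖ < 1 := by
    rw [norm_smul, RCLike.norm_conj]
    nlinarith [norm_nonneg z]
  set g := Ring.inverse (((U : H ≃L[ℂ] H) : H →L[ℂ] H) - z • (1 : H →L[ℂ] H)) f with hg
  set h := Ring.inverse (1 - starRingEnd ℂ z • ((U : H ≃L[ℂ] H) : H →L[ℂ] H)) e with hh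
  have hgf : U g - z • g = f :=
    congrArg (fun T : H →L[ℂ] H => T f) (Ring.mul_inverse_cancel _ hu)
  have hhe : h - starRingEnd ℂ z • U h = e :=
    congrArg (fun T : H →L[ℂ] H => T e)
      (Ring.mul_inverse_cancel _ (isUnit_one_sub_of_norm_lt_one hz'))
  rcases le_or_gt ‖z‖ (1 / 2) with hz2 | hz2
  · have h1 := abs_one_sub_norm_mul_norm_le U z g
    rw [hgf, abs_of_pos (by linarith)] at h1
    have h2 : ‖g‖ ≤ 2 := by nlinarith [norm_nonneg g]
    have h3 := norm_inner_le_norm (𝕜 := ℂ) e g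
    nlinarith [norm_nonneg g, norm_nonneg e, norm_nonneg (inner ℂ f h)]
  · have key : z * inner ℂ e g = inner ℂ h f - inner ℂ e f := by
      rw [← hgf, ← hhe]
      simp only [inner_sub_left, inner_sub_right, inner_smul_left, inner_smul_right,
        Complex.conj_conj, U.inner_map_map]
      ring
    have h1 := congrArg norm key
    rw [norm_mul] at h1
    have h2 := norm_sub_le (inner ℂ h f) (inner ℂ e f)
    have h3 := norm_inner_le_norm (𝕜 := ℂ) e f
    rw [norm_inner_symm h f] at h2
    nlinarith [norm_nonneg (inner ℂ e g), norm_nonneg f, norm_nonneg e]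

/-- The resolvent is `-z⁻¹ (1 - z⁻¹ A)⁻¹`, and `|z⁻¹| ≤ 1`. -/
lemma norm_inner_inverse_sub_le_of_one_lt_norm {A : H →L[ℂ] H} {z : ℂ} (hz : 1 < ‖z‖)
    (hA : ‖A‖ ≤ 1) (e f : H) :
    ‖inner ℂ e (Ring.inverse (A - z • (1 : H →L[ℂ] H)) f)‖ ≤
      ‖inner ℂ e (Ring.inverse (1 - z⁻¹ • A) f)‖ := by
  have hz0 : z ≠ 0 := norm_pos_iff.1 (zero_lt_one.trans hz)
  have hz' : ‖z⁻¹ • A‖ < 1 := by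
    rw [norm_smul, norm_inv, inv_mul_lt_iff₀ (by positivity)]
    linarith
  have hu := isUnit_one_sub_of_norm_lt_one hz'
  have hsub : -z⁻¹ • (A - z • (1 : H →L[ℂ] H)) = 1 - z⁻¹ • A := by
    rw [neg_smul, smul_sub, smul_smul, inv_mul_cancel₀ hz0, one_smul, neg_sub]
  have h1 : (A - z • (1 : H →L[ℂ] H)) * (-z⁻¹ • Ring.inverse (1 - z⁻¹ • A)) = 1 := by
    rw [mul_smul_comm, ← smul_mul_assoc, hsub, Ring.mul_inverse_cancel _ hu]
  have h2 : (-z⁻¹ • Ring.inverse (1 - z⁻¹ • A)) * (A - z • (1 : H →L[ℂ] H)) = 1 := by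
    rw [smul_mul_assoc, ← mul_smul_comm, hsub, Ring.inverse_mul_cancel _ hu]
  rw [show Ring.inverse (A - z • (1 : H →L[ℂ] H)) = -z⁻¹ • Ring.inverse (1 - z⁻¹ • A) from
    Ring.inverse_unit ⟨_, _, h1, h2⟩]
  rw [smul_apply, inner_smul_right, norm_mul, norm_neg, norm_inv]
  exact mul_le_of_le_one_left (norm_nonneg _) (inv_le_one_of_one_le₀ hz.le)

/-- The bound on the fractional moments of the resolvent matrix elements. -/
def resolventMomentBound (s : ℝ) : ℝ≥0 := 2 * (Real.toNNReal (2 * Real.pi) + momentBound s)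

/-- The fractional moment bound for a family of unitary operators `(1 + (e^{iθ} - 1) P) A`. -/
lemma lintegral_inner_inverse_sub_le {s : ℝ} (hs : s ∈ Set.Ioo (0 : ℝ) 1) (U : ℝ → H ≃ₗᵢ[ℂ] H)
    {A P : H →L[ℂ] H} (hA : ‖A‖ ≤ 1)
    (hP : ∀ w : ℂ, ‖w‖ ≤ 1 → ‖1 + (w - 1) • P‖ ≤ 1)
    (hU : ∀ θ, ((U θ : H ≃L[ℂ] H) : H →L[ℂ] H) = (1 + (circleMap 0 1 θ - 1) • P) * A)
    {z : ℂ} (hz : ‖z‖ ≠ 1)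
    (hu : ∀ θ, IsUnit (((U θ : H ≃L[ℂ] H) : H →L[ℂ] H) - z • (1 : H →L[ℂ] H)))
    {e f : H} (he : ∀ v, inner ℂ e (P v) = inner ℂ e v) (hf : ∀ v, inner ℂ f (P v) = inner ℂ f v)
    (he1 : ‖e‖ ≤ 1) (hf1 : ‖f‖ ≤ 1) :
    ∫⁻ θ in Set.Ioc 0 (2 * Real.pi), ‖inner ℂ e
      (Ring.inverse (((U θ : H ≃L[ℂ] H) : H →L[ℂ] H) - z • (1 : H →L[ℂ] H)) f)‖ₑ ^ s ≤
      resolventMomentBound s := by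
  have hU1 : ∀ θ, ‖((U θ : H ≃L[ℂ] H) : H →L[ℂ] H)‖ ≤ 1 := fun θ =>
    ContinuousLinearMap.opNorm_le_bound _ zero_le_one fun v => by simp
  -- A common form for both sides of the unit circle: `c = z̄` with `e, f` exchanged inside, `c =
  -- z⁻¹` outside.
  suffices h : ∃ (c : ℂ) (e' f' : H), ‖c‖ < 1 ∧ (∀ v, inner ℂ e' (P v) = inner ℂ e' v) ∧
      (∀ v, inner ℂ f' (P v) = inner ℂ f' v) ∧ ‖e'‖ ≤ 1 ∧ ‖f'‖ ≤ 1 ∧ ∀ θ, ‖inner ℂ e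
      (Ring.inverse (((U θ : H ≃L[ℂ] H) : H →L[ℂ] H) - z • (1 : H →L[ℂ] H)) f)‖ ≤
      2 * (1 + ‖inner ℂ e' (Ring.inverse (1 - c • ((U θ : H ≃L[ℂ] H) : H →L[ℂ] H)) f')‖) by
    obtain ⟨c, e', f', hc, he', hf', he1', hf1', hle⟩ := h
    have hcA : ‖c • A‖ < 1 := by
      rw [norm_smul]
      nlinarith [norm_nonneg c]
    have hb := lintegral_inner_inverse_le hs hcA hP he' hf' he1' hf1'
    calc _ ≤ ∫⁻ θ in Set.Ioc 0 (2 * Real.pi), 2 * (1 + ‖inner ℂ e'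
          (Ring.inverse (1 - (1 + (circleMap 0 1 θ - 1) • P) * (c • A)) f')‖ₑ ^ s) := by
          refine lintegral_mono fun θ => ?_
          have h1 := hle θ
          nth_rewrite 2 [hU] at h1
          rw [← mul_smul_comm] at h1
          have h2 := ENNReal.ofReal_le_ofReal h1
          rw [ENNReal.ofReal_mul zero_le_two, ENNReal.ofReal_add zero_le_one (norm_nonneg _),
            ofReal_norm, ofReal_norm, ENNReal.ofReal_one, ENNReal.ofReal_ofNat] at h2
          refine (ENNReal.rpow_le_rpow h2 hs.1.le).trans ?_
          rw [ENNReal.mul_rpow_of_nonneg _ _ hs.1.le]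
          gcongr
          · exact (ENNReal.rpow_le_rpow_of_exponent_le one_le_two hs.2.le).trans
              (ENNReal.rpow_one _).le
          · refine (ENNReal.rpow_add_le_add_rpow _ _ hs.1.le hs.2.le).trans (le_of_eq ?_)
            rw [ENNReal.one_rpow]
      _ ≤ _ := by
          rw [lintegral_const_mul' _ _ (by simp), lintegral_add_left measurable_const]
          rw [resolventMomentBound]
          push_cast
          gcongr
          simp [ENNReal.ofReal]
  rcases hz.lt_or_gt with hz | hz
  · refine ⟨starRingEnd ℂ z, f, e, by simpa using hz, hf, he, hf1, he1, fun θ => ?_⟩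
    exact norm_inner_inverse_sub_le_of_norm_lt_one (U θ) hz (hu θ) (hU1 θ) he1 hf1
  · refine ⟨z⁻¹, e, f, ?_, he, hf, he1, hf1, fun θ => ?_⟩
    · rw [norm_inv]
      exact inv_lt_one_of_one_lt₀ hz
    · have := norm_inner_inverse_sub_le_of_one_lt_norm hz (hU1 θ) e f
      linarith [norm_nonneg (inner ℂ e
        (Ring.inverse (1 - z⁻¹ • ((U θ : H ≃L[ℂ] H) : H →L[ℂ] H)) f))]

end Unitary

/-! ### Phases on a set of sites. -/

lemma norm_ket (x : Site) (i : Fin 3) : ‖ket x i‖ = 1 := by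
  rw [ket, lp.norm_single (by norm_num)]
  simp

lemma inner_ket (x : Site) (i : Fin 3) (ψ : Hil) : inner ℂ (ket x i) ψ = ψ x i := by
  rw [ket, lp.inner_single_left]
  simp [EuclideanSpace.inner_single_left]

lemma norm_le_norm_of_forall_le {φ ψ : Hil} (h : ∀ x, ‖φ x‖ ≤ ‖ψ x‖) : ‖φ‖ ≤ ‖ψ‖ :=
  (sq_le_sq₀ (norm_nonneg _) (norm_nonneg _)).1 <|
    hasSum_le (fun x => pow_le_pow_left₀ (norm_nonneg _) (h x) 2) (hasSum_norm_sq φ)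
      (hasSum_norm_sq ψ)

open Classical in
/-- The restriction of a vector to the set `T` of sites. -/
def restrictSites (T : Set Site) : Hil →L[ℂ] Hil :=
  LinearMap.mkContinuous
    { toFun := fun ψ => ⟨fun x => if x ∈ T then ψ x else 0, memℓp_two_of_summable <|
        (hasSum_norm_sq ψ).summable.of_nonneg_of_le (fun _ => sq_nonneg _) fun x => by
          by_cases hx : x ∈ T <;> simp [hx]⟩
      map_add' := fun ψ φ => by
        ext1
        funext x
        change (if x ∈ T then ψ x + φ x else 0) =
          (if x ∈ T then ψ x else 0) + if x ∈ T then φ x else 0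
        by_cases hx : x ∈ T <;> simp [hx]
      map_smul' := fun c ψ => by
        ext1
        funext x
        by_cases hx : x ∈ T <;> simp [hx] } 1 fun ψ => by
    rw [one_mul]
    refine norm_le_norm_of_forall_le fun x => ?_
    by_cases hx : x ∈ T <;> simp [hx]

lemma restrictSites_apply_of_mem {T : Set Site} {x : Site} (hx : x ∈ T) (ψ : Hil) :
    restrictSites T ψ x = ψ x := if_pos hx

lemma restrictSites_apply_of_notMem {T : Set Site} {x : Site} (hx : x ∉ T) (ψ : Hil) :
    restrictSites T ψ x = 0 := if_neg hx

lemma inner_ket_restrictSites {T : Set Site} {x : Site} (hx : x ∈ T) (i : Fin 3) (ψ : Hil) :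
    inner ℂ (ket x i) (restrictSites T ψ) = inner ℂ (ket x i) ψ := by
  rw [inner_ket, inner_ket, restrictSites_apply_of_mem hx]

/-- The operator multiplies by `w` on `T` and by `1` elsewhere. The bound is needed on the whole
disc, where the holomorphic extension in `w` lives. -/
lemma norm_one_add_smul_restrictSites_le (T : Set Site) {w : ℂ} (hw : ‖w‖ ≤ 1) :
    ‖1 + (w - 1) • restrictSites T‖ ≤ 1 := by
  refine ContinuousLinearMap.opNorm_le_bound _ zero_le_one fun ψ => ?_
  rw [one_mul]
  refine norm_le_norm_of_forall_le fun x => ?_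
  have hx : ((1 + (w - 1) • restrictSites T) ψ) x = ψ x + (w - 1) • restrictSites T ψ x := rfl
  rw [hx]
  by_cases hxT : x ∈ T
  · rw [restrictSites_apply_of_mem hxT, sub_smul, one_smul, add_sub_cancel, norm_smul]
    exact mul_le_of_le_one_left (norm_nonneg _) hw
  · rw [restrictSites_apply_of_notMem hxT, smul_zero, add_zero]

lemma phaseOp_apply (ω : Site → ℝ) (ψ : Hil) (x : Site) :
    phaseOp ω ψ x = (Circle.exp (ω x) : ℂ) • ψ x := rfl

lemma walk_apply (C : Site → Matrix.unitaryGroup (Fin 3) ℂ) (ω : Site → ℝ) (ψ : Hil) :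
    walk C ω ψ = phaseOp ω (shiftOp (coinOp C ψ)) := rfl

/-- A common additional phase `θ` on the set `T` of sites. -/
lemma walk_add_indicator (C : Site → Matrix.unitaryGroup (Fin 3) ℂ) (ω : Site → ℝ) (T : Set Site)
    (θ : ℝ) :
    ((walk C (ω + T.indicator fun _ => θ) : Hil ≃L[ℂ] Hil) : Hil →L[ℂ] Hil) =
      (1 + (circleMap 0 1 θ - 1) • restrictSites T) *
        ((walk C ω : Hil ≃L[ℂ] Hil) : Hil →L[ℂ] Hil) := by
  ext1 ψ
  ext1
  funext x
  have hl : ((walk C (ω + T.indicator fun _ => θ) : Hil ≃L[ℂ] Hil) : Hil →L[ℂ] Hil) ψ x =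
    (Circle.exp (ω x + T.indicator (fun _ => θ) x) : ℂ) • shiftOp (coinOp C ψ) x := rfl
  have hr : ((1 + (circleMap 0 1 θ - 1) • restrictSites T) *
        ((walk C ω : Hil ≃L[ℂ] Hil) : Hil →L[ℂ] Hil)) ψ x =
      walk C ω ψ x + (circleMap 0 1 θ - 1) • restrictSites T (walk C ω ψ) x := rfl
  have hw : walk C ω ψ x = (Circle.exp (ω x) : ℂ) • shiftOp (coinOp C ψ) x := rfl
  rw [hl, hr]
  by_cases hx : x ∈ T
  · rw [restrictSites_apply_of_mem hx, sub_smul, one_smul, add_sub_cancel, hw, smul_smul,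
      Set.indicator_of_mem hx, Circle.exp_add, mul_comm]
    simp [circleMap, Circle.coe_exp]
  · rw [restrictSites_apply_of_notMem hx, Set.indicator_of_notMem hx, hw]
    simp

/-! ### Continuity and measurability in the phases. -/

/-- In the product topology only finitely many phases are controlled, so continuity is strong, not
in norm; dominated convergence handles the far sites. -/
lemma continuous_phaseOp_apply (ψ : Hil) : Continuous fun ω => phaseOp ω ψ := by
  refine continuous_iff_continuousAt.2 fun ω₀ => tendsto_iff_norm_sub_tendsto_zero.2 ?_
  have h : Filter.Tendsto (fun ω => ∑' x, ‖(phaseOp ω ψ - phaseOp ω₀ ψ) x‖ ^ 2) (nhds ω₀)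
      (nhds (∑' _ : Site, 0)) := by
    refine tendsto_tsum_of_dominated_convergence
      (bound := fun x => 4 * ‖ψ x‖ ^ 2) ((hasSum_norm_sq ψ).summable.mul_left 4) (fun x => ?_)
      (.of_forall fun ω x => ?_)
    · simp only [lp.coeFn_sub, Pi.sub_apply, phaseOp_apply]
      have hc : Continuous fun ω : Site → ℝ =>
          ‖(Circle.exp (ω x) : ℂ) • ψ x - (Circle.exp (ω₀ x) : ℂ) • ψ x‖ ^ 2 := by fun_prop
      simpa using hc.tendsto ω₀
    · have h1 : ‖(phaseOp ω ψ - phaseOp ω₀ ψ) x‖ ≤ 2 * ‖ψ x‖ := by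
        refine (norm_sub_le (phaseOp ω ψ x) (phaseOp ω₀ ψ x)).trans ?_
        rw [phaseOp_apply, phaseOp_apply, norm_smul, norm_smul, Circle.norm_coe, Circle.norm_coe]
        linarith
      rw [Real.norm_of_nonneg (sq_nonneg _)]
      refine (pow_le_pow_left₀ (norm_nonneg _) h1 2).trans (le_of_eq (by ring))
  rw [tsum_zero] at h
  have h2 : ∀ ω, ∑' x, ‖(phaseOp ω ψ - phaseOp ω₀ ψ) x‖ ^ 2 = ‖phaseOp ω ψ - phaseOp ω₀ ψ‖ ^ 2 :=
    fun ω => (hasSum_norm_sq _).tsum_eq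
  simp only [h2] at h
  simpa using h.sqrt

/-- By the resolvent identity, `(U_ω - z)(g ω - g ω₀) = -(U_ω - U_ω₀) g ω₀`. Since `U_ω - z` is
bounded below by `|1 - |z||` uniformly in `ω`, strong continuity at the fixed vector `g ω₀`
suffices. -/
lemma continuous_green (C : Site → Matrix.unitaryGroup (Fin 3) ℂ) {z : ℂ} (hz : ‖z‖ ≠ 1)
    (x : Site) (i : Fin 3) (y : Site) (j : Fin 3) : Continuous fun ω => green C ω z x i y j := by
  suffices h : Continuous fun ω => resolventOp C ω z (ket y j) from
    continuous_const.inner h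
  have hz' : 0 < |1 - ‖z‖| := abs_pos.2 (sub_ne_zero.2 hz.symm)
  have hR : ∀ ω ψ, walk C ω (resolventOp C ω z ψ) - z • resolventOp C ω z ψ = ψ := fun ω ψ =>
    congrArg (fun T : Hil →L[ℂ] Hil => T ψ) (Ring.mul_inverse_cancel _ (isUnit_walk_sub C ω hz))
  refine continuous_iff_continuousAt.2 fun ω₀ => tendsto_iff_norm_sub_tendsto_zero.2 ?_
  set g := fun ω => resolventOp C ω z (ket y j) with hg
  have hle : ∀ ω, ‖g ω - g ω₀‖ ≤ |1 - ‖z‖|⁻¹ * ‖walk C ω (g ω₀) - walk C ω₀ (g ω₀)‖ := fun ω => by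
    rw [le_inv_mul_iff₀ hz']
    refine (abs_one_sub_norm_mul_norm_le (walk C ω) z (g ω - g ω₀)).trans (le_of_eq ?_)
    rw [← norm_neg]
    congr 1
    have h1 := hR ω (ket y j)
    have h2 := hR ω₀ (ket y j)
    have h3 : walk C ω (g ω) = ket y j + z • g ω := sub_eq_iff_eq_add.1 h1
    have h4 : walk C ω₀ (g ω₀) = ket y j + z • g ω₀ := sub_eq_iff_eq_add.1 h2
    rw [map_sub, h3, h4, smul_sub]
    abel
  refine squeeze_zero (fun _ => norm_nonneg _) hle ?_
  have hc : Continuous fun ω => |1 - ‖z‖|⁻¹ * ‖walk C ω (g ω₀) - walk C ω₀ (g ω₀)‖ :=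
    continuous_const.mul (((continuous_phaseOp_apply _).sub continuous_const).norm)
  simpa using hc.tendsto ω₀

lemma measurable_green_rpow (C : Site → Matrix.unitaryGroup (Fin 3) ℂ) {z : ℂ} (hz : ‖z‖ ≠ 1)
    (x : Site) (i : Fin 3) (y : Site) (j : Fin 3) (s : ℝ) :
    Measurable fun ω => ‖green C ω z x i y j‖ₑ ^ s :=
  (continuous_green C hz x i y j).measurable.enorm.pow_const s

/-! ### Averaging over the phases at two sites. -/

/-- The fractional moment bound for a common phase of the sites `x` and `y`. -/
lemma lintegral_green_add_indicator_le {s : ℝ} (hs : s ∈ Set.Ioo (0 : ℝ) 1)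
    (C : Site → Matrix.unitaryGroup (Fin 3) ℂ) (ω : Site → ℝ) {z : ℂ} (hz : ‖z‖ ≠ 1)
    (x : Site) (i : Fin 3) (y : Site) (j : Fin 3) :
    ∫⁻ θ in Set.Ioc 0 (2 * Real.pi),
      ‖green C (ω + ({x, y} : Set Site).indicator fun _ => θ) z x i y j‖ₑ ^ s ≤
      resolventMomentBound s :=
  lintegral_inner_inverse_sub_le hs (fun θ => walk C (ω + ({x, y} : Set Site).indicator fun _ => θ))
    (ContinuousLinearMap.opNorm_le_bound _ zero_le_one fun v => by simp)
    (fun _ => norm_one_add_smul_restrictSites_le _)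
    (walk_add_indicator C ω {x, y}) hz (fun _ => isUnit_walk_sub C _ hz)
    (inner_ket_restrictSites (by simp) i) (inner_ket_restrictSites (by simp) j)
    (norm_ket x i).le (norm_ket y j).le

lemma walk_congr (C : Site → Matrix.unitaryGroup (Fin 3) ℂ) {ω ω' : Site → ℝ}
    (h : ∀ x, Circle.exp (ω x) = Circle.exp (ω' x)) : walk C ω = walk C ω' := by
  ext1 ψ
  ext1
  funext x
  rw [walk_apply, walk_apply, phaseOp_apply, phaseOp_apply, h]

lemma green_congr (C : Site → Matrix.unitaryGroup (Fin 3) ℂ) {ω ω' : Site → ℝ}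
    (h : ∀ x, Circle.exp (ω x) = Circle.exp (ω' x)) (z : ℂ)
    (x : Site) (i : Fin 3) (y : Site) (j : Fin 3) :
    green C ω z x i y j = green C ω' z x i y j := by
  rw [green, green, resolventOp, resolventOp, walk_congr C h]

/-- Translation moves the interval to another fundamental domain of the period lattice. -/
lemma setLIntegral_Ioc_add_right_of_periodic {T : ℝ} (hT : 0 < T) {f : ℝ → ℝ≥0∞}
    (hf : Function.Periodic f T) (b : ℝ) :
    ∫⁻ a in Set.Ioc 0 T, f (a + b) = ∫⁻ a in Set.Ioc 0 T, f a := by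
  have h1 := (measurePreserving_add_right (volume : Measure ℝ) b).setLIntegral_comp_preimage_emb
    (measurableEmbedding_addRight b) f (Set.Ioc b (b + T))
  rw [Set.preimage_add_const_Ioc, sub_self, add_sub_cancel_left] at h1
  rw [h1]
  have h2 := (isAddFundamentalDomain_Ioc hT b).setLIntegral_eq (isAddFundamentalDomain_Ioc hT 0) f
    hf.map_vadd_zmultiples
  rwa [zero_add] at h2

lemma measure_le_of_density_le {μ : Measure ℝ} {τ : ℝ → ℝ≥0∞} {M : ℝ≥0}
    (hμ : μ = (volume.restrict (Set.Ico 0 (2 * Real.pi))).withDensity τ)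
    (hM : ∀ᵐ θ ∂(volume.restrict (Set.Ico 0 (2 * Real.pi))), τ θ ≤ M) :
    μ ≤ (M : ℝ≥0∞) • volume.restrict (Set.Ioc 0 (2 * Real.pi)) := by
  rw [hμ, ← withDensity_const, ← restrict_Ico_eq_restrict_Ioc]
  exact withDensity_mono hM

/-- The phase `b` becomes common to `x` and `y` over a configuration free of `b`, with the value `0`
at `y`. For `x = y` the outer update wins and both sides have the value `b` there. -/
lemma update_update_add (ω : Site → ℝ) (x y : Site) (a b : ℝ) :
    Function.update (Function.update ω x (a + b)) y b =
      Function.update (Function.update ω x a) y 0 + ({x, y} : Set Site).indicator fun _ => b := by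
  funext v
  by_cases hy : v = y
  · subst hy
    simp
  · by_cases hx : v = x
    · subst hx
      simp [hy]
    · simp [hx, hy]

/-- The bound for two phases that are integrated with respect to a law of bounded density. -/
lemma lintegral_lintegral_green_le {μ : Measure ℝ} {M : ℝ≥0}
    (hμ : μ ≤ (M : ℝ≥0∞) • volume.restrict (Set.Ioc 0 (2 * Real.pi)))
    {s : ℝ} (hs : s ∈ Set.Ioo (0 : ℝ) 1)
    (C : Site → Matrix.unitaryGroup (Fin 3) ℂ) (ω : Site → ℝ) {z : ℂ} (hz : ‖z‖ ≠ 1)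
    (x : Site) (i : Fin 3) (y : Site) (j : Fin 3) :
    ∫⁻ b, ∫⁻ a, ‖green C (Function.update (Function.update ω x a) y b) z x i y j‖ₑ ^ s ∂μ ∂μ ≤
      (M ^ 2 * (Real.toNNReal (2 * Real.pi) * resolventMomentBound s) : ℝ≥0) := by
  set I := Set.Ioc 0 (2 * Real.pi)
  have hm : Measurable fun p : ℝ × ℝ =>
      ‖green C (Function.update (Function.update ω x (p.1 + p.2)) y p.2) z x i y j‖ₑ ^ s := by
    have hu : Continuous fun p : ℝ × ℝ =>
        Function.update (Function.update ω x (p.1 + p.2)) y p.2 :=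
      ((continuous_const (y := ω)).update x (continuous_fst.add continuous_snd)).update y
        continuous_snd
    exact (measurable_green_rpow C hz x i y j s).comp hu.measurable
  -- Lebesgue measure must replace `μ` before the shift of `a`, because `μ` need not be invariant
  -- under rotation.
  calc ∫⁻ b, ∫⁻ a, ‖green C (Function.update (Function.update ω x a) y b) z x i y j‖ₑ ^ s ∂μ ∂μ
      ≤ ∫⁻ b, ∫⁻ a, ‖green C (Function.update (Function.update ω x a) y b) z x i y j‖ₑ ^ s
          ∂((M : ℝ≥0∞) • volume.restrict I) ∂((M : ℝ≥0∞) • volume.restrict I) :=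
        lintegral_mono' hμ fun b => lintegral_mono' hμ le_rfl
    _ = M * (M * ∫⁻ b in I, ∫⁻ a in I,
          ‖green C (Function.update (Function.update ω x a) y b) z x i y j‖ₑ ^ s) := by
        simp only [lintegral_smul_measure, smul_eq_mul]
        rw [lintegral_const_mul' _ _ ENNReal.coe_ne_top]
    _ = M * (M * ∫⁻ b in I, ∫⁻ a in I,
          ‖green C (Function.update (Function.update ω x (a + b)) y b) z x i y j‖ₑ ^ s) := by
        congr 2
        refine lintegral_congr fun b => (setLIntegral_Ioc_add_right_of_periodic
          Real.two_pi_pos (f := fun a =>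
            ‖green C (Function.update (Function.update ω x a) y b) z x i y j‖ₑ ^ s)
            (fun a => ?_) b).symm
        simp only
        rw [green_congr C fun v => ?_]
        by_cases hy : v = y
        · subst hy
          simp
        · by_cases hx : v = x
          · subst hx
            simp [hy, Circle.exp_add]
          · simp [hx, hy]
    -- The common phase `b` becomes the inner variable; the relative phase `a` is only a parameter
    -- and contributes a factor `2π`.
    _ = M * (M * ∫⁻ a in I, ∫⁻ b in I,
          ‖green C (Function.update (Function.update ω x (a + b)) y b) z x i y j‖ₑ ^ s) := by
        rw [lintegral_lintegral_swap]
        exact (hm.comp measurable_swap).aemeasurable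
    _ ≤ M * (M * ∫⁻ _ in I, resolventMomentBound s) := by
        gcongr with a
        simp only [update_update_add]
        exact lintegral_green_add_indicator_le hs C _ hz x i y j
    _ = _ := by
        rw [setLIntegral_const, Real.volume_Ioc, sub_zero, ENNReal.ofReal]
        push_cast
        ring

/-! ### Resampling coordinates of a product measure. -/

section Product

variable {ι : Type*} [DecidableEq ι] {X : ι → Type*} [∀ i, MeasurableSpace (X i)]
  (μ : ∀ i, Measure (X i)) [∀ i, IsProbabilityMeasure (μ i)]

/-- Resampling one coordinate leaves an infinite product measure invariant. -/
lemma map_update_infinitePi_prod (y : ι) :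
    ((Measure.infinitePi μ).prod (μ y)).map (fun p => Function.update p.1 y p.2) =
      Measure.infinitePi μ := by
  have hm : Measurable fun p : (∀ i, X i) × X y => Function.update p.1 y p.2 :=
    measurable_update'
  -- Finite cylinders determine the measure; the factor at `y`, if constrained, now comes from the
  -- independent copy.
  refine Measure.eq_infinitePi μ fun t u hu => ?_
  rw [Measure.map_apply hm (.pi t.countable_toSet fun i _ => hu i)]
  by_cases hy : y ∈ t
  · have hpre : (fun p : (∀ i, X i) × X y => Function.update p.1 y p.2) ⁻¹' Set.pi t u =
        Set.pi (t.erase y) u ×ˢ u y := by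
      ext p
      simp only [Set.mem_preimage, Set.mem_pi, Set.mem_prod, Finset.mem_coe, Finset.mem_erase]
      constructor
      · intro h
        exact ⟨fun i hi => by simpa [hi.1] using h i hi.2, by simpa using h y hy⟩
      · rintro ⟨h1, h2⟩ i hi
        by_cases hiy : i = y
        · subst hiy
          simpa using h2
        · simpa [hiy] using h1 i ⟨hiy, hi⟩
    rw [hpre, Measure.prod_prod, Measure.infinitePi_pi μ fun i _ => hu i,
      Finset.prod_erase_mul _ _ hy]
  · have hpre : (fun p : (∀ i, X i) × X y => Function.update p.1 y p.2) ⁻¹' Set.pi t u =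
        Set.pi t u ×ˢ Set.univ := by
      ext p
      simp only [Set.mem_preimage, Set.mem_pi, Set.mem_prod, Finset.mem_coe, Set.mem_univ,
        and_true]
      refine forall₂_congr fun i hi => ?_
      rw [Function.update_of_ne (by rintro rfl; exact hy hi)]
    rw [hpre, Measure.prod_prod, Measure.infinitePi_pi μ fun i _ => hu i, measure_univ, mul_one]

lemma lintegral_infinitePi_update (y : ι) {f : (∀ i, X i) → ℝ≥0∞} (hf : Measurable f) :
    ∫⁻ ω, f ω ∂Measure.infinitePi μ =
      ∫⁻ ω, ∫⁻ b, f (Function.update ω y b) ∂μ y ∂Measure.infinitePi μ := by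
  have hm : Measurable fun p : (∀ i, X i) × X y => Function.update p.1 y p.2 :=
    measurable_update'
  conv_lhs => rw [← map_update_infinitePi_prod μ y]
  rw [lintegral_map hf hm]
  exact lintegral_prod _ (hf.comp hm).aemeasurable

end Product

end HexWalk

end

/-! ### The two bounds. -/

/-- `μ` is the common law of the phases. In the first bound, the phases at `x` and `y` are
integrated and all other phases keep their values in `ω`; for `x = y` there is one phase to
integrate, and the second update overrides the first. The second bound is for the full expectation
over i.i.d. phases. -/
theorem mainTheorem3 (μ : Measure ℝ) [IsProbabilityMeasure μ]
    (hμ : HexWalk.HasBoundedDensityOnTorus μ) (s : ℝ) (hs : s ∈ Set.Ioo (0 : ℝ) 1) :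
    ∃ K : ℝ≥0,
      ∀ (C : HexWalk.Site → Matrix.unitaryGroup (Fin 3) ℂ) (z : ℂ), ‖z‖ ≠ 1 →
        ∀ (x y : HexWalk.Site) (i j : Fin 3),
          (∀ ω : HexWalk.Site → ℝ,
            ∫⁻ b, ∫⁻ a,
              ‖HexWalk.green C (Function.update (Function.update ω x a) y b) z x i y j‖ₑ ^ s
                ∂μ ∂μ ≤ K) ∧
          (∀ (Ω : Type*) [MeasurableSpace Ω] (P : Measure Ω) [IsProbabilityMeasure P]
            (ω : HexWalk.Site → Ω → ℝ), (∀ v, Measurable (ω v)) → iIndepFun ω P →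
            (∀ v, P.map (ω v) = μ) →
            ∫⁻ w, ‖HexWalk.green C (fun v => ω v w) z x i y j‖ₑ ^ s ∂P ≤ K) := by
  obtain ⟨τ, -, hτ, M, hM⟩ := hμ
  have hle := HexWalk.measure_le_of_density_le hτ hM
  refine ⟨M ^ 2 * (Real.toNNReal (2 * Real.pi) * HexWalk.resolventMomentBound s),
    fun C z hz x y i j => ?_⟩
  have hbound := fun ω => HexWalk.lintegral_lintegral_green_le hle hs C ω hz x i y j
  refine ⟨hbound, fun Ω _ P _ ω hω hind hlaw => ?_⟩
  have hmap : P.map (fun w v => ω v w) = Measure.infinitePi fun _ : HexWalk.Site => μ := by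
    rw [(iIndepFun_iff_map_fun_eq_infinitePi_map hω).1 hind]
    simp only [hlaw]
  have hG := HexWalk.measurable_green_rpow C hz x i y j s
  have hm : Measurable fun p : (HexWalk.Site → ℝ) × ℝ => Function.update p.1 y p.2 :=
    measurable_update'
  have hG' : Measurable fun ω : HexWalk.Site → ℝ =>
      ∫⁻ b, ‖HexWalk.green C (Function.update ω y b) z x i y j‖ₑ ^ s ∂μ :=
    (hG.comp hm).lintegral_prod_right'
  -- Resampling `y` before `x` leaves the update at `y` outermost, as in `hbound`, so the case `x =
  -- y` needs no separate treatment.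
  rw [← lintegral_map (f := fun ω => ‖HexWalk.green C ω z x i y j‖ₑ ^ s) hG
    (measurable_pi_lambda _ hω), hmap,
    HexWalk.lintegral_infinitePi_update (fun _ : HexWalk.Site => μ) y hG,
    HexWalk.lintegral_infinitePi_update (fun _ : HexWalk.Site => μ) x hG']
  have hswap : ∀ ω : HexWalk.Site → ℝ, ∫⁻ a, ∫⁻ b, ‖HexWalk.green C
      (Function.update (Function.update ω x a) y b) z x i y j‖ₑ ^ s ∂μ ∂μ ≤
      (M ^ 2 * (Real.toNNReal (2 * Real.pi) * HexWalk.resolventMomentBound s) : ℝ≥0) := fun ω => by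
    have hu : Continuous fun p : ℝ × ℝ => Function.update (Function.update ω x p.1) y p.2 :=
      ((continuous_const (y := ω)).update x continuous_fst).update y continuous_snd
    rw [lintegral_lintegral_swap]
    · exact hbound ω
    · exact (hG.comp hu.measurable).aemeasurable
  refine (lintegral_mono hswap).trans (le_of_eq ?_)
  rw [lintegral_const, measure_univ, mul_one]
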